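/- Let $\mathbb{F}$ be a division ring, $\sigma : \mathbb{F} \to \mathbb{F}$ a ring endomorphism and $\delta : \mathbb{F} \to \mathbb{F}$ a $\sigma$-derivation (an additive map with $\delta(ab) = \sigma(a)\delta(b) + \delta(a)b$ for all $a,b$). Let $\mathbb{F}[x;\sigma,\delta]$ be the skew polynomial ring, that is, the left $\mathbb{F}$-vector space with basis $\{x^i \mid i \in \mathbb{N}\}$ with the product determined by $xa = \sigma(a)x + \delta(a)$ for $a \in \mathbb{F}$. For $F, P \in \mathbb{F}[x;\sigma,\delta]$ with $P \neq 0$, let $F(P)$ be the remainder of the Euclidean division of $F$ by $P$ on the right (so $F = QP + F(P)$ for some $Q$, and $\deg F(P) < \deg P$). For a set $\Omega$ of skew polynomials of degree at least $1$, let $I(\Omega) = \{ F \mid F(P) = 0 \text{ for all } P \in \Omega \}$. The set $\Omega$ is called algebraic if $I(\Omega) \neq \{0\}$; in that case $F_\Omega$ denotes the unique monic non-zero skew polynomial of minimum possible degree in $I(\Omega)$. The set $\Omega$ is called P-independent if it is finite, algebraic and $\deg(F_\Omega) = \sum_{P \in \Omega} \deg(P)$. For $a, b \in \mathbb{F}$,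 we say that $b$ is conjugate to $a$ if $b = \sigma(\beta) a \beta^{-1} + \delta(\beta)\beta^{-1}$ for some $\beta \in \mathbb{F}^*$ (this is an equivalence relation). **Theorem (Union).** Let $n, m \geq 1$ and let $\Omega = \{ (x-a_1)^{r_1}, \ldots, (x-a_n)^{r_n} \}$ and $\Psi = \{ (x-b_1)^{s_1}, \ldots, (x-b_m)^{s_m} \}$ be P-independent subsets of $\mathbb{F}[x;\sigma,\delta]$ of sizes $n$ and $m$, respectively, where $a_1, \ldots, a_n, b_1, \ldots, b_m \in \mathbb{F}$ and $r_1, \ldots, r_n, s_1, \ldots, s_m$ are positive integers. If no element of $\{a_1, \ldots, a_n\}$ is conjugate to an element of $\{b_1, \ldots, b_m\}$, then $\Omega \cup \Psi$ has size $n+m$ and is P-independent. -/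

import Mathlib

/-- A `σ`-derivation of `F`: an additive map with `δ (a b) = σ a δ b + δ a b`. -/
structure SkewDerivation {F : Type*} [DivisionRing F] (σ : F →+* F) extends F →+ F where
  leibniz : ∀ a b : F, toFun (a * b) = σ a * toFun b + toFun a * b

/-- The skew polynomial ring `F[x; σ, δ]`. As a left `F`-vector space it has basis
`x ^ i`, `i : ℕ`: a skew polynomial is its finitely supported sequence of left coefficients.
The product, determined by `x a = σ a x + δ a`, is constructed below. -/
def SkewPoly {F : Type*} [DivisionRing F] (σ : F →+* F) (_δ : SkewDerivation σ) : Type _ :=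
  ℕ →₀ F

namespace SkewPoly

section Construction

variable {F : Type*} [DivisionRing F] {σ : F →+* F} {δ : SkewDerivation σ}

noncomputable instance : AddCommGroup (SkewPoly σ δ) := inferInstanceAs (AddCommGroup (ℕ →₀ F))

noncomputable instance : Module F (SkewPoly σ δ) := inferInstanceAs (Module F (ℕ →₀ F))

/-- The underlying finitely supported sequence of coefficients. -/
def toFinsupp (p : SkewPoly σ δ) : ℕ →₀ F := p

/-- The coefficient of `x ^ i`. -/
def coeff (p : SkewPoly σ δ) (i : ℕ) : F := toFinsupp p i

/-- The monomial `c x ^ i`. -/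
noncomputable def monomial (i : ℕ) : F →+ SkewPoly σ δ :=
  (Finsupp.singleAddHom i : F →+ (ℕ →₀ F))

theorem coeff_ext {p q : SkewPoly σ δ} (h : ∀ i, coeff p i = coeff q i) : p = q :=
  Finsupp.ext (f := toFinsupp p) (g := toFinsupp q) h

theorem coeff_add (p q : SkewPoly σ δ) (i : ℕ) : coeff (p + q) i = coeff p i + coeff q i := rfl

theorem coeff_sub (p q : SkewPoly σ δ) (i : ℕ) : coeff (p - q) i = coeff p i - coeff q i :=
  Finsupp.sub_apply (toFinsupp p) (toFinsupp q) i

theorem coeff_zero (i : ℕ) : coeff (0 : SkewPoly σ δ) i = 0 := rfl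

theorem coeff_smul (c : F) (p : SkewPoly σ δ) (i : ℕ) : coeff (c • p) i = c * coeff p i := rfl

theorem coeff_monomial (i : ℕ) (c : F) (j : ℕ) :
    coeff (monomial i c : SkewPoly σ δ) j = if i = j then c else 0 :=
  Finsupp.single_apply

theorem smul_monomial (b : F) (i : ℕ) (c : F) :
    b • (monomial i c : SkewPoly σ δ) = monomial i (b * c) := by
  refine coeff_ext fun j => ?_
  rw [coeff_smul, coeff_monomial, coeff_monomial, mul_ite, mul_zero]

theorem hom_ext {A : Type*} [AddCommMonoid A] {f g : SkewPoly σ δ →+ A}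
    (h : ∀ i c, f (monomial i c) = g (monomial i c)) : f = g :=
  Finsupp.addHom_ext (M := F) (f := (show (ℕ →₀ F) →+ A from f)) (g := g) h

/-- Left multiplication by `x`: it sends `c x ^ i` to `σ c x ^ (i + 1) + δ c x ^ i`. -/
noncomputable def xMul : AddMonoid.End (SkewPoly σ δ) :=
  (Finsupp.liftAddHom fun i =>
    (monomial (i + 1)).comp σ.toAddMonoidHom + (monomial i).comp δ.toAddMonoidHom :
      (ℕ →₀ F) →+ SkewPoly σ δ)

theorem xMul_monomial (i : ℕ) (c : F) :
    xMul (monomial i c : SkewPoly σ δ) = monomial (i + 1) (σ c) + monomial i (δ.toFun c) :=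
  Finsupp.liftAddHom_apply_single (M := F) (N := SkewPoly σ δ) _ i c

theorem xMul_smul (b : F) (p : SkewPoly σ δ) :
    xMul (b • p) = σ b • xMul p + δ.toFun b • p := by
  have h : (xMul : AddMonoid.End (SkewPoly σ δ)).comp (DistribSMul.toAddMonoidHom _ b) =
      (DistribSMul.toAddMonoidHom _ (σ b)).comp xMul +
        DistribSMul.toAddMonoidHom _ (δ.toFun b) := by
    refine hom_ext fun i c => ?_
    change xMul (b • (monomial i c : SkewPoly σ δ)) =
      σ b • xMul (monomial i c : SkewPoly σ δ) + δ.toFun b • (monomial i c : SkewPoly σ δ)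
    rw [smul_monomial, xMul_monomial, xMul_monomial, smul_add, smul_monomial, smul_monomial,
      smul_monomial, map_mul, δ.leibniz, map_add, add_assoc]
  exact DFunLike.congr_fun h p

/-- Left multiplication by a skew polynomial: `c x ^ i` acts as `q ↦ c • x (x (⋯ (x q)))`. -/
noncomputable def mulHom : SkewPoly σ δ →+ AddMonoid.End (SkewPoly σ δ) :=
  (Finsupp.liftAddHom fun i =>
    (AddMonoidHom.mulRight (xMul ^ i : AddMonoid.End (SkewPoly σ δ))).comp
      (Module.toAddMonoidEnd F (SkewPoly σ δ)).toAddMonoidHom :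
      (ℕ →₀ F) →+ AddMonoid.End (SkewPoly σ δ))

theorem mulHom_monomial (i : ℕ) (c : F) (q : SkewPoly σ δ) :
    mulHom (monomial i c) q = c • (xMul ^ i : AddMonoid.End (SkewPoly σ δ)) q :=
  DFunLike.congr_fun (Finsupp.liftAddHom_apply_single (M := F)
    (N := AddMonoid.End (SkewPoly σ δ)) _ i c) q

theorem mulHom_smul (b : F) (p q : SkewPoly σ δ) : mulHom (b • p) q = b • mulHom p q := by
  have h : (mulHom.flip q).comp (DistribSMul.toAddMonoidHom (SkewPoly σ δ) b) =
      (DistribSMul.toAddMonoidHom _ b).comp (mulHom.flip q) := by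
    refine hom_ext fun i c => ?_
    change mulHom (b • monomial i c) q = b • mulHom (monomial i c) q
    rw [smul_monomial, mulHom_monomial, mulHom_monomial, mul_smul]
  exact DFunLike.congr_fun h p

theorem mulHom_xMul (p q : SkewPoly σ δ) : mulHom (xMul p) q = xMul (mulHom p q) := by
  have h : (mulHom.flip q).comp (xMul : AddMonoid.End (SkewPoly σ δ)) =
      (xMul : AddMonoid.End (SkewPoly σ δ)).comp (mulHom.flip q) := by
    refine hom_ext fun i c => ?_
    change mulHom (xMul (monomial i c)) q = xMul (mulHom (monomial i c) q)
    rw [xMul_monomial, map_add]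
    change mulHom (monomial (i + 1) (σ c)) q + mulHom (monomial i (δ.toFun c)) q = _
    rw [mulHom_monomial, mulHom_monomial, mulHom_monomial, xMul_smul, pow_succ']
    rfl
  exact DFunLike.congr_fun h p

noncomputable instance : Mul (SkewPoly σ δ) := ⟨fun p q => mulHom p q⟩

noncomputable instance : One (SkewPoly σ δ) := ⟨monomial 0 1⟩

theorem mul_def (p q : SkewPoly σ δ) : p * q = mulHom p q := rfl

theorem one_def : (1 : SkewPoly σ δ) = monomial 0 1 := rfl

protected theorem mul_assoc (p q t : SkewPoly σ δ) : p * q * t = p * (q * t) := by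
  have hx : ∀ i : ℕ, mulHom ((xMul ^ i : AddMonoid.End (SkewPoly σ δ)) q) t =
      (xMul ^ i : AddMonoid.End (SkewPoly σ δ)) (mulHom q t) := by
    intro i
    induction i with
    | zero => rfl
    | succ i ih =>
      rw [pow_succ']
      change mulHom (xMul ((xMul ^ i : AddMonoid.End (SkewPoly σ δ)) q)) t =
        xMul ((xMul ^ i : AddMonoid.End (SkewPoly σ δ)) (mulHom q t))
      rw [mulHom_xMul, ih]
  have h : (mulHom.flip t).comp (mulHom.flip q) = mulHom.flip (mulHom q t) := by
    refine hom_ext fun i c => ?_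
    change mulHom (mulHom (monomial i c) q) t = mulHom (monomial i c) (mulHom q t)
    rw [mulHom_monomial, mulHom_monomial, mulHom_smul, hx]
  exact DFunLike.congr_fun h p

protected theorem one_mul (p : SkewPoly σ δ) : 1 * p = p := by
  rw [mul_def, one_def, mulHom_monomial, one_smul]
  rfl

theorem xMul_pow_one (i : ℕ) :
    (xMul ^ i : AddMonoid.End (SkewPoly σ δ)) (monomial 0 1) = monomial i 1 := by
  induction i with
  | zero => rfl
  | succ i ih =>
    have hd : δ.toFun 1 = 0 := by
      have := δ.leibniz 1 1
      simpa using this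
    rw [pow_succ']
    change xMul ((xMul ^ i : AddMonoid.End (SkewPoly σ δ)) (monomial 0 1)) = _
    rw [ih, xMul_monomial, map_one, hd, map_zero, add_zero]

protected theorem mul_one (p : SkewPoly σ δ) : p * 1 = p := by
  have h : (mulHom.flip (1 : SkewPoly σ δ)) = AddMonoidHom.id _ := by
    refine hom_ext fun i c => ?_
    change mulHom (monomial i c) (1 : SkewPoly σ δ) = monomial i c
    rw [mulHom_monomial, one_def, xMul_pow_one, smul_monomial, mul_one]
  exact DFunLike.congr_fun h p

noncomputable instance : Ring (SkewPoly σ δ) :=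
  { (inferInstance : AddCommGroup (SkewPoly σ δ)) with
    mul := (· * ·)
    one := 1
    mul_assoc := SkewPoly.mul_assoc
    one_mul := SkewPoly.one_mul
    mul_one := SkewPoly.mul_one
    left_distrib := fun p q t => map_add (mulHom p) q t
    right_distrib := fun p q t => DFunLike.congr_fun (map_add mulHom p q) t
    zero_mul := fun p => DFunLike.congr_fun (map_zero mulHom) p
    mul_zero := fun p => map_zero (mulHom p) }

/-- Constants, as a subring of `F[x; σ, δ]`. -/
noncomputable def C : F →+* SkewPoly σ δ :=
  { monomial 0 with
    map_one' := rfl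
    map_mul' := fun a b => by
      change monomial 0 (a * b) = mulHom (monomial 0 a) (monomial 0 b)
      rw [mulHom_monomial, ← smul_monomial]
      rfl }

/-- The variable `x`. -/
noncomputable def X : SkewPoly σ δ := monomial 1 1

theorem C_mul (c : F) (p : SkewPoly σ δ) : C c * p = c • p :=
  mulHom_monomial 0 c p

theorem X_mul (p : SkewPoly σ δ) : X * p = xMul p := by
  change mulHom (monomial 1 1) p = _
  rw [mulHom_monomial, one_smul, pow_one]

/-- The defining commutation rule `x a = σ a x + δ a`. -/
theorem X_mul_C (a : F) :
    (X : SkewPoly σ δ) * C a = C (σ a) * X + C (δ.toFun a) := by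
  rw [X_mul, C_mul, X, smul_monomial, mul_one]
  exact xMul_monomial 0 a

theorem X_pow (i : ℕ) : (X : SkewPoly σ δ) ^ i = monomial i 1 := by
  induction i with
  | zero => rfl
  | succ i ih =>
    rw [pow_succ', ih, X_mul, ← xMul_pow_one i, ← xMul_pow_one (i + 1),
      pow_succ' (xMul : AddMonoid.End (SkewPoly σ δ)) i]
    rfl

theorem monomial_eq (i : ℕ) (c : F) : (monomial i c : SkewPoly σ δ) = C c * X ^ i := by
  rw [X_pow, C_mul, smul_monomial, mul_one]

/-- The degree, with `degree 0 = ⊥` (that is, `-∞`). -/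
def degree (p : SkewPoly σ δ) : WithBot ℕ := (toFinsupp p).support.max

/-- Monic skew polynomials: the coefficient in the degree is `1`. -/
def Monic (p : SkewPoly σ δ) : Prop := ∃ d : ℕ, degree p = d ∧ coeff p d = 1

/-- `P` divides `G` on the right. -/
def RightDvd (P G : SkewPoly σ δ) : Prop := ∃ Q : SkewPoly σ δ, G = Q * P

end Construction

section Division

variable {F : Type*} [DivisionRing F] {σ : F →+* F} {δ : SkewDerivation σ}

theorem degree_lt_iff (p : SkewPoly σ δ) (d : ℕ) :
    degree p < d ↔ ∀ i, d ≤ i → coeff p i = 0 := by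
  unfold degree
  rw [Finset.max_eq_sup_withBot]
  refine (Finset.sup_lt_iff (WithBot.bot_lt_coe d)).trans ?_
  constructor
  · intro h i hi
    by_contra hne
    have := h i (Finsupp.mem_support_iff.2 hne)
    exact absurd (WithBot.coe_lt_coe.1 this) (not_lt.2 hi)
  · intro h i hi
    by_contra hlt
    exact Finsupp.mem_support_iff.1 hi (h i (WithBot.coe_le_coe.1 (not_lt.1 hlt)))

theorem degree_eq_iff (p : SkewPoly σ δ) (d : ℕ) :
    degree p = d ↔ coeff p d ≠ 0 ∧ ∀ i, d < i → coeff p i = 0 := by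
  constructor
  · intro h
    refine ⟨fun h0 => ?_, (degree_lt_iff p (d + 1)).1 ?_⟩
    · exact Finsupp.mem_support_iff.1 (Finset.mem_of_max h) h0
    · rw [h]; exact WithBot.coe_lt_coe.2 d.lt_succ_self
  · rintro ⟨h0, h1⟩
    refine le_antisymm ?_ (Finset.le_max (Finsupp.mem_support_iff.2 h0))
    refine Finset.max_le fun i hi => WithBot.coe_le_coe.2 ?_
    by_contra hlt
    exact Finsupp.mem_support_iff.1 hi (h1 i (not_le.1 hlt))

theorem degree_eq_bot_iff (p : SkewPoly σ δ) : degree p = ⊥ ↔ p = 0 := by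
  unfold degree
  rw [Finset.max_eq_bot, Finsupp.support_eq_empty]
  rfl

theorem exists_degree_eq {p : SkewPoly σ δ} (hp : p ≠ 0) : ∃ d : ℕ, degree p = d := by
  obtain ⟨d, hd⟩ := WithBot.ne_bot_iff_exists.1 (mt (degree_eq_bot_iff p).1 hp)
  exact ⟨d, hd.symm⟩

theorem coeff_xMul_succ (p : SkewPoly σ δ) (i : ℕ) :
    coeff (xMul p) (i + 1) = σ (coeff p i) + δ.toFun (coeff p (i + 1)) := by
  let ev : ℕ → (SkewPoly σ δ →+ F) := fun i => (Finsupp.applyAddHom i : (ℕ →₀ F) →+ F)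
  have h : (ev (i + 1)).comp (xMul : AddMonoid.End (SkewPoly σ δ)) =
      σ.toAddMonoidHom.comp (ev i) + δ.toAddMonoidHom.comp (ev (i + 1)) := by
    refine hom_ext fun j c => ?_
    change coeff (xMul (monomial j c : SkewPoly σ δ)) (i + 1) =
      σ (coeff (monomial j c : SkewPoly σ δ) i) +
        δ.toAddMonoidHom (coeff (monomial j c : SkewPoly σ δ) (i + 1))
    rw [xMul_monomial, coeff_add, coeff_monomial, coeff_monomial, coeff_monomial, coeff_monomial]
    congr 1
    · by_cases hj : j = i <;> simp [hj]
    · by_cases hj : j = i + 1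
      · simp only [hj, if_true]; rfl
      · simp only [hj, if_false]; exact (map_zero δ.toAddMonoidHom).symm
  exact DFunLike.congr_fun h p

theorem coeff_xMul_pow {p : SkewPoly σ δ} {d : ℕ} (h : ∀ i, d < i → coeff p i = 0) (k : ℕ) :
    coeff ((xMul ^ k : AddMonoid.End (SkewPoly σ δ)) p) (k + d) = σ^[k] (coeff p d) ∧
      ∀ i, k + d < i → coeff ((xMul ^ k : AddMonoid.End (SkewPoly σ δ)) p) i = 0 := by
  have hd0 : δ.toFun 0 = 0 := map_zero δ.toAddMonoidHom
  induction k with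
  | zero => simpa using h
  | succ k ih =>
    have hs : (xMul ^ (k + 1) : AddMonoid.End (SkewPoly σ δ)) p =
        xMul ((xMul ^ k : AddMonoid.End (SkewPoly σ δ)) p) := by
      rw [pow_succ']; rfl
    rw [hs]
    constructor
    · rw [show k + 1 + d = (k + d) + 1 by omega, coeff_xMul_succ, ih.1,
        ih.2 _ (Nat.lt_succ_self _), hd0, add_zero, Function.iterate_succ_apply']
    · intro i hi
      obtain ⟨j, rfl⟩ : ∃ j, i = j + 1 := ⟨i - 1, by omega⟩
      rw [coeff_xMul_succ, ih.2 j (by omega), ih.2 (j + 1) (by omega), hd0, map_zero, add_zero]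

theorem coeff_monomial_mul {p : SkewPoly σ δ} {d : ℕ} (h : ∀ i, d < i → coeff p i = 0)
    (k : ℕ) (c : F) :
    coeff (monomial k c * p) (k + d) = c * σ^[k] (coeff p d) ∧
      ∀ i, k + d < i → coeff (monomial k c * p) i = 0 := by
  rw [mul_def, mulHom_monomial]
  refine ⟨?_, fun i hi => ?_⟩
  · rw [coeff_smul, (coeff_xMul_pow h k).1]
  · rw [coeff_smul, (coeff_xMul_pow h k).2 i hi, mul_zero]

theorem coeff_mul_top {p : SkewPoly σ δ} {d : ℕ} (hp : ∀ i, d < i → coeff p i = 0) (k : ℕ) :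
    ∀ q : SkewPoly σ δ, (∀ i, k < i → coeff q i = 0) →
    coeff (q * p) (k + d) = coeff q k * σ^[k] (coeff p d) ∧
      ∀ i, k + d < i → coeff (q * p) i = 0 := by
  induction k with
  | zero =>
    intro q hq
    have hq' : q = monomial 0 (coeff q 0) := by
      refine coeff_ext fun i => ?_
      rw [coeff_monomial]
      rcases i with _ | i
      · simp
      · simpa using hq (i + 1) (Nat.succ_pos i)
    rw [hq', coeff_monomial, if_pos rfl]
    exact coeff_monomial_mul hp 0 _
  | succ k ih =>
    intro q hq
    have hr : ∀ i, k < i → coeff (q - monomial (k + 1) (coeff q (k + 1))) i = 0 := by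
      intro i hi
      rw [coeff_sub, coeff_monomial]
      by_cases h : k + 1 = i
      · subst h; simp
      · rw [if_neg h, hq i (by omega), sub_zero]
    have hm := coeff_monomial_mul hp (k + 1) (coeff q (k + 1))
    have hi := ih _ hr
    have hs : q * p = (q - monomial (k + 1) (coeff q (k + 1))) * p +
        monomial (k + 1) (coeff q (k + 1)) * p := by
      rw [← add_mul, sub_add_cancel]
    rw [hs]
    refine ⟨?_, fun i h => ?_⟩
    · rw [coeff_add, hm.1, hi.2 _ (by omega), zero_add]
    · rw [coeff_add, hm.2 i h, hi.2 i (by omega), zero_add]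

/-- Degrees add up in products. -/
theorem degree_mul (p q : SkewPoly σ δ) : degree (p * q) = degree p + degree q := by
  by_cases hp : p = 0
  · rw [hp, zero_mul, (degree_eq_bot_iff (0 : SkewPoly σ δ)).2 rfl, WithBot.bot_add]
  by_cases hq : q = 0
  · rw [hq, mul_zero, (degree_eq_bot_iff (0 : SkewPoly σ δ)).2 rfl, WithBot.add_bot]
  obtain ⟨k, hk⟩ := exists_degree_eq hp
  obtain ⟨d, hd⟩ := exists_degree_eq hq
  have hk' := (degree_eq_iff p k).1 hk
  have hd' := (degree_eq_iff q d).1 hd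
  have h := coeff_mul_top hd'.2 k p hk'.2
  rw [hk, hd, ← Nat.cast_add]
  refine (degree_eq_iff _ _).2 ⟨?_, h.2⟩
  rw [h.1]
  refine mul_ne_zero hk'.1 fun h0 => hd'.1 ?_
  exact σ.injective.iterate k (h0.trans (iterate_map_zero σ k).symm)

/-- Euclidean division on the right. -/
theorem exists_div (G : SkewPoly σ δ) {P : SkewPoly σ δ} (hP : P ≠ 0) :
    ∃ Q R : SkewPoly σ δ, G = Q * P + R ∧ degree R < degree P := by
  obtain ⟨d, hd⟩ := exists_degree_eq hP
  have hd' := (degree_eq_iff P d).1 hd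
  simp only [hd, degree_lt_iff]
  suffices H : ∀ (N : ℕ) (G : SkewPoly σ δ), (∀ i, d + N ≤ i → coeff G i = 0) →
      ∃ Q R : SkewPoly σ δ, G = Q * P + R ∧ ∀ i, d ≤ i → coeff R i = 0 by
    by_cases hG : G = 0
    · exact ⟨0, 0, by rw [hG, zero_mul, add_zero], fun i _ => coeff_zero i⟩
    obtain ⟨e, he⟩ := exists_degree_eq hG
    exact H (e + 1) G fun i hi => ((degree_eq_iff G e).1 he).2 i (by omega)
  intro N
  induction N with
  | zero => exact fun G h => ⟨0, G, by rw [zero_mul, zero_add], h⟩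
  | succ N ih =>
    intro G h
    have hne : σ^[N] (coeff P d) ≠ 0 := fun h0 =>
      hd'.1 (σ.injective.iterate N (h0.trans (iterate_map_zero σ N).symm))
    have hm := coeff_monomial_mul hd'.2 N (coeff G (N + d) * (σ^[N] (coeff P d))⁻¹)
    rw [inv_mul_cancel_right₀ hne] at hm
    obtain ⟨Q, R, hQ, hR⟩ :=
      ih (G - monomial N (coeff G (N + d) * (σ^[N] (coeff P d))⁻¹) * P) (by
        intro i hi
        rw [coeff_sub]
        rcases eq_or_lt_of_le hi with h' | h'
        · rw [← h', add_comm d N, hm.1, sub_self]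
        · rw [hm.2 i (by omega), h i (by omega), sub_zero])
    refine ⟨Q + monomial N (coeff G (N + d) * (σ^[N] (coeff P d))⁻¹), R, ?_, hR⟩
    rw [add_mul, add_right_comm, ← hQ, sub_add_cancel]

theorem degree_sub_lt {p q : SkewPoly σ δ} {D : WithBot ℕ} (hp : degree p < D)
    (hq : degree q < D) : degree (p - q) < D := by
  by_cases h : p - q = 0
  · rw [(degree_eq_bot_iff _).2 h]
    exact lt_of_le_of_lt bot_le hp
  obtain ⟨e, he⟩ := exists_degree_eq h
  by_contra hlt
  rw [he, not_lt] at hlt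
  refine ((degree_eq_iff _ e).1 he).1 ?_
  rw [coeff_sub, (degree_lt_iff p e).1 (lt_of_lt_of_le hp hlt) e le_rfl,
    (degree_lt_iff q e).1 (lt_of_lt_of_le hq hlt) e le_rfl, sub_zero]

/-- The remainder of Euclidean division on the right by a nonzero `P` exists and is unique. -/
theorem existsUnique_remainder (G : SkewPoly σ δ) {P : SkewPoly σ δ} (hP : P ≠ 0) :
    ∃! R : SkewPoly σ δ, degree R < degree P ∧ ∃ Q : SkewPoly σ δ, G = Q * P + R := by
  obtain ⟨Q, R, h, hR⟩ := exists_div G hP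
  refine ⟨R, ⟨hR, Q, h⟩, ?_⟩
  rintro R' ⟨hR', Q', h'⟩
  have hs : (Q - Q') * P = R' - R := by
    rw [sub_mul, sub_eq_sub_iff_add_eq_add, ← h, h', add_comm]
  have hlt := degree_sub_lt hR' hR
  rw [← hs, degree_mul] at hlt
  by_cases h0 : Q - Q' = 0
  · rw [h0, zero_mul] at hs
    exact sub_eq_zero.1 hs.symm
  obtain ⟨k, hk⟩ := exists_degree_eq h0
  obtain ⟨d, hd⟩ := exists_degree_eq hP
  rw [hk, hd, ← Nat.cast_add, Nat.cast_lt] at hlt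
  exact absurd hlt (by omega)

end Division

section Zeros

variable {F : Type*} [DivisionRing F] {σ : F →+* F} {δ : SkewDerivation σ}

open Classical in
/-- The evaluation `G(P)`: the remainder of the Euclidean division on the right of `G` by `P`.
(For `P = 0`, where there is no division, the value is `G`.) -/
noncomputable def eval (G P : SkewPoly σ δ) : SkewPoly σ δ :=
  if hP : P = 0 then G else (existsUnique_remainder G hP).choose

theorem eval_spec (G : SkewPoly σ δ) {P : SkewPoly σ δ} (hP : P ≠ 0) :
    degree (eval G P) < degree P ∧ ∃ Q : SkewPoly σ δ, G = Q * P + eval G P := by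
  unfold eval
  rw [dif_neg hP]
  exact (existsUnique_remainder G hP).choose_spec.1

/-- `P` is a zero of `G` if and only if `P` divides `G` on the right. -/
theorem eval_eq_zero_iff (G P : SkewPoly σ δ) : eval G P = 0 ↔ RightDvd P G := by
  by_cases hP : P = 0
  · unfold eval RightDvd
    rw [dif_pos hP]
    simp [hP]
  · constructor
    · intro h
      obtain ⟨Q, hQ⟩ := (eval_spec G hP).2
      exact ⟨Q, by rwa [h, add_zero] at hQ⟩
    · rintro ⟨Q, hQ⟩
      refine (existsUnique_remainder G hP).unique (eval_spec G hP) ⟨?_, Q, by rw [add_zero, hQ]⟩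
      rw [(degree_eq_bot_iff (0 : SkewPoly σ δ)).2 rfl]
      exact bot_lt_iff_ne_bot.2 (mt (degree_eq_bot_iff P).1 hP)

/-- `I(Ω)`: the skew polynomials vanishing at every `P ∈ Ω`. -/
def vanishing (Ω : Set (SkewPoly σ δ)) : Set (SkewPoly σ δ) :=
  {G | ∀ P ∈ Ω, eval G P = 0}

/-- `Ω` is algebraic if `I(Ω) ≠ {0}`. -/
def IsAlgebraicSet (Ω : Set (SkewPoly σ δ)) : Prop := vanishing Ω ≠ {0}

theorem sub_mem_vanishing {Ω : Set (SkewPoly σ δ)} {G H : SkewPoly σ δ}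
    (hG : G ∈ vanishing Ω) (hH : H ∈ vanishing Ω) : G - H ∈ vanishing Ω := by
  intro P hP
  obtain ⟨Q, hQ⟩ := (eval_eq_zero_iff G P).1 (hG P hP)
  obtain ⟨Q', hQ'⟩ := (eval_eq_zero_iff H P).1 (hH P hP)
  exact (eval_eq_zero_iff _ P).2 ⟨Q - Q', by rw [hQ, hQ', sub_mul]⟩

theorem mul_mem_vanishing {Ω : Set (SkewPoly σ δ)} (H : SkewPoly σ δ) {G : SkewPoly σ δ}
    (hG : G ∈ vanishing Ω) : H * G ∈ vanishing Ω := by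
  intro P hP
  obtain ⟨Q, hQ⟩ := (eval_eq_zero_iff G P).1 (hG P hP)
  exact (eval_eq_zero_iff _ P).2 ⟨H * Q, by rw [hQ, mul_assoc]⟩

/-- An algebraic set has a unique monic vanishing skew polynomial of minimum degree among the
nonzero vanishing ones. -/
theorem existsUnique_minPoly {Ω : Set (SkewPoly σ δ)} (hΩ : IsAlgebraicSet Ω) :
    ∃! G : SkewPoly σ δ, G ∈ vanishing Ω ∧ Monic G ∧
      ∀ H ∈ vanishing Ω, H ≠ 0 → degree G ≤ degree H := by
  classical
  have hz : (0 : SkewPoly σ δ) ∈ vanishing Ω := fun P _ =>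
    (eval_eq_zero_iff 0 P).2 ⟨0, (zero_mul P).symm⟩
  have hex : ∃ d : ℕ, ∃ G ∈ vanishing Ω, degree G = d := by
    by_contra hno
    refine hΩ (Set.eq_singleton_iff_unique_mem.2 ⟨hz, fun G hG => ?_⟩)
    by_contra hne
    obtain ⟨d, hd⟩ := exists_degree_eq hne
    exact hno ⟨d, G, hG, hd⟩
  obtain ⟨G, hG, hd⟩ := Nat.find_spec hex
  have hmin : ∀ H ∈ vanishing Ω, H ≠ 0 → ((Nat.find hex : ℕ) : WithBot ℕ) ≤ degree H := by
    intro H hH hne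
    obtain ⟨e, he⟩ := exists_degree_eq hne
    rw [he]
    exact WithBot.coe_le_coe.2 (Nat.find_min' hex ⟨H, hH, he⟩)
  generalize Nat.find hex = d at hd hmin
  have hG' := (degree_eq_iff G d).1 hd
  have h1 : coeff (C (coeff G d)⁻¹ * G) d = 1 := by
    rw [C_mul, coeff_smul, inv_mul_cancel₀ hG'.1]
  have h2 : degree (C (coeff G d)⁻¹ * G) = d := by
    refine (degree_eq_iff _ d).2 ⟨by rw [h1]; exact one_ne_zero, fun i hi => ?_⟩
    rw [C_mul, coeff_smul, hG'.2 i hi, mul_zero]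
  refine ⟨C (coeff G d)⁻¹ * G, ⟨mul_mem_vanishing _ hG, ⟨d, h2, h1⟩, by rwa [h2]⟩, ?_⟩
  rintro G' ⟨hG1, ⟨e, he, he1⟩, hm⟩
  have hne : C (coeff G d)⁻¹ * G ≠ 0 := fun h0 => by
    rw [h0, coeff_zero] at h1
    exact zero_ne_one h1
  have hne' : G' ≠ 0 := fun h0 => by
    rw [h0, coeff_zero] at he1
    exact zero_ne_one he1
  have hed : e = d := by
    refine le_antisymm ?_ ?_
    · have := hm _ (mul_mem_vanishing (C (coeff G d)⁻¹) hG) hne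
      rw [he, h2] at this
      exact WithBot.coe_le_coe.1 this
    · have := hmin _ hG1 hne'
      rw [he] at this
      exact WithBot.coe_le_coe.1 this
  subst hed
  by_contra hdiff
  have hle := hmin _ (sub_mem_vanishing hG1 (mul_mem_vanishing (C (coeff G e)⁻¹) hG))
    (sub_ne_zero.2 hdiff)
  refine absurd hle (not_le.2 ((degree_lt_iff _ e).2 fun i hi => ?_))
  rw [coeff_sub]
  rcases eq_or_lt_of_le hi with h | h
  · rw [← h, he1, h1, sub_self]
  · rw [((degree_eq_iff _ e).1 he).2 i h, ((degree_eq_iff _ e).1 h2).2 i h, sub_zero]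

open Classical in
/-- The minimal skew polynomial of `Ω`: the unique monic nonzero element of minimum possible
degree of `I(Ω)` if `Ω` is algebraic, and `0` otherwise. -/
noncomputable def minPoly (Ω : Set (SkewPoly σ δ)) : SkewPoly σ δ :=
  if hΩ : IsAlgebraicSet Ω then (existsUnique_minPoly hΩ).choose else 0

theorem minPoly_spec {Ω : Set (SkewPoly σ δ)} (hΩ : IsAlgebraicSet Ω) :
    minPoly Ω ∈ vanishing Ω ∧ Monic (minPoly Ω) ∧
      ∀ H ∈ vanishing Ω, H ≠ 0 → degree (minPoly Ω) ≤ degree H := by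
  unfold minPoly
  rw [dif_pos hΩ]
  exact (existsUnique_minPoly hΩ).choose_spec.1

/-- P-independence of a set `Ω` of skew polynomials of degree at least one: `Ω` is finite,
algebraic, and the degree of its minimal skew polynomial is the sum of the degrees of its
elements. -/
def PIndependent (Ω : Set (SkewPoly σ δ)) : Prop :=
  (∀ P ∈ Ω, 1 ≤ degree P) ∧ Ω.Finite ∧ IsAlgebraicSet Ω ∧
    degree (minPoly Ω) = ∑ᶠ P ∈ Ω, degree P

/-- `b` is a `(σ, δ)`-conjugate of `a`: `b = σ β a β⁻¹ + δ β β⁻¹` for some nonzero `β`. -/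
def IsConjugate (σ : F →+* F) (δ : SkewDerivation σ) (a b : F) : Prop :=
  ∃ β : F, β ≠ 0 ∧ b = σ β * a * β⁻¹ + δ.toFun β * β⁻¹

end Zeros

end SkewPoly

/-! Write `R` for the skew polynomial ring. The point is that `I(Ω) + I(Ψ) = R`; the rest is a
dimension count over `F`. Each cyclic module `R / R(x - a)` is one-dimensional over `F`, so `R / R(x
- a)^k` is an iterated extension of copies of it, and `R / I(Ω)` embeds in the product of the
modules `R / R(x - a_i)^{r_i}`. Hence every nonzero subquotient of `R / I(Ω)` contains an
eigenvector of `x` with eigenvalue some `a_i`; this is the property `IsLinearlyFiltered`, stable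
under intersections (`IsLinearlyFiltered.inf`) and products (`IsLinearlyFiltered.span_mul`). The
same holds for `Ψ` and the `b_j`. If `L = I(Ω) + I(Ψ)` were proper, the common quotient `R / L`
would contain an eigenvector `v` for some `b_j`. The line `F v` is a submodule, so it also contains
an eigenvector `β v` for some `a_i`. Since `x β = σ(β) x + δ(β)`, this makes `a_i` a conjugate of
`b_j`, a contradiction (`sup_eq_top_of_not_isConjugate`). Comaximality gives `deg F_{Ω ∪ Ψ} = deg
F_Ω + deg F_Ψ` (`degree_minPoly_union`) and forbids a common element of `Ω` and `Ψ`, so that the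
degree sums add up as well. -/

namespace SkewPoly

variable {F : Type*} [DivisionRing F] {σ : F →+* F} {δ : SkewDerivation σ}

/-! ### Eigenvectors of `x` in subquotients, and comaximality. -/

section Filtered

/-- Every nonzero subquotient of `F[x; σ, δ] / I` contains a nonzero vector `v` with
`(x - a) v = 0` for some `a ∈ A`. -/
def IsLinearlyFiltered (A : Set F) (I : Ideal (SkewPoly σ δ)) : Prop :=
  ∀ N N' : Ideal (SkewPoly σ δ), I ≤ N → N < N' →
    ∃ v ∈ N', v ∉ N ∧ ∃ a ∈ A, (X - C a) * v ∈ N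

theorem isLinearlyFiltered_top (A : Set F) :
    IsLinearlyFiltered A (⊤ : Ideal (SkewPoly σ δ)) :=
  fun _ _ h h' => absurd (lt_of_le_of_lt h h') not_top_lt

/-- The part of the extension argument concerning the quotient by `I`. -/
theorem IsLinearlyFiltered.exists_of_inf_le {A : Set F} {I N N' : Ideal (SkewPoly σ δ)}
    (hI : IsLinearlyFiltered A I) (hN : N < N') (h : N' ⊓ I ≤ N) :
    ∃ v ∈ N', v ∉ N ∧ ∃ a ∈ A, (X - C a) * v ∈ N := by
  -- By the modular law, `N ≤ N'` with equal joins with `I` and `N' ⊓ I ≤ N` would give `N = N'`.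
  have hlt : N ⊔ I < N' ⊔ I := by
    refine lt_of_le_of_ne (sup_le_sup_right hN.le I) fun he => hN.ne ?_
    exact eq_of_le_of_inf_le_of_sup_le hN.le (le_inf h inf_le_right) he.ge
  obtain ⟨v', hv', hnv', a, ha, hav'⟩ := hI _ _ le_sup_right hlt
  obtain ⟨v, hv, i, hi, rfl⟩ := Submodule.mem_sup.1 hv'
  refine ⟨v, hv, fun hvN => hnv' (Submodule.add_mem_sup hvN hi), a, ha, ?_⟩
  obtain ⟨w, hw, j, hj, hwj⟩ := Submodule.mem_sup.1 hav'
  -- The correction term lies in `I`, and also in `N'` as a difference of two elements of `N'`;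
  -- hence it lies in `N`.
  have hk : (X - C a) * v = w + (j - (X - C a) * i) := by
    rw [mul_add] at hwj
    rw [← add_sub_assoc, hwj, add_sub_cancel_right]
  have hkI : j - (X - C a) * i ∈ I := I.sub_mem hj (I.mul_mem_left _ hi)
  rw [hk]
  refine N.add_mem hw (h ⟨?_, hkI⟩)
  rw [← add_sub_cancel_left w (j - (X - C a) * i), ← hk]
  exact N'.sub_mem (N'.mul_mem_left _ hv) (hN.le hw)

/-- If `N' ⊓ I ≤ N`, the subquotient `N' / N` is already visible in `R / I`. Otherwise `N ⊓ I < N' ⊓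
I`, and this pair is visible in `R / J` because `I ⊓ J ≤ N`. -/
theorem IsLinearlyFiltered.inf {A : Set F} {I J : Ideal (SkewPoly σ δ)}
    (hI : IsLinearlyFiltered A I) (hJ : IsLinearlyFiltered A J) :
    IsLinearlyFiltered A (I ⊓ J) := by
  intro N N' hIN hN
  by_cases h : N' ⊓ I ≤ N
  · exact hI.exists_of_inf_le hN h
  obtain ⟨y, hy, hyN⟩ := SetLike.not_le_iff_exists.1 h
  have hlt : (N ⊓ I) < N' ⊓ I :=
    lt_of_le_of_ne (inf_le_inf_right I hN.le) fun he => hyN (he.ge hy).1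
  obtain ⟨v, hv, hvN, a, ha, hav⟩ := hJ.exists_of_inf_le hlt
    fun z hz => ⟨hIN ⟨hz.1.2, hz.2⟩, hz.1.2⟩
  exact ⟨v, hv.1, fun hvN' => hvN ⟨hvN', hv.2⟩, a, ha, hav.1⟩

/-- `R / RQP` is an extension of `R / RP` by `RP / RQP`, and right multiplication by `P` maps `R /
RQ` onto the latter. Subquotients not seen in `R / RP` are therefore pulled back along `q ↦ q * P`.
-/
theorem IsLinearlyFiltered.span_mul {A : Set F} {P Q : SkewPoly σ δ}
    (hQ : IsLinearlyFiltered A (Ideal.span {Q})) (hP : IsLinearlyFiltered A (Ideal.span {P})) :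
    IsLinearlyFiltered A (Ideal.span {Q * P}) := by
  intro N N' hIN hN
  by_cases h : N' ⊓ Ideal.span {P} ≤ N
  · exact hP.exists_of_inf_le hN h
  obtain ⟨y, hy, hyN⟩ := SetLike.not_le_iff_exists.1 h
  obtain ⟨q, rfl⟩ := Ideal.mem_span_singleton'.1 hy.2
  let f : SkewPoly σ δ →ₗ[SkewPoly σ δ] SkewPoly σ δ := LinearMap.toSpanSingleton _ _ P
  have hf : ∀ z, f z = z * P := fun z => rfl
  obtain ⟨v, hv, hvN, a, ha, hav⟩ := hQ (Submodule.comap f N) (Submodule.comap f N')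
    ((Ideal.span_singleton_le_iff_mem _).2 (hIN (Ideal.mem_span_singleton_self _)))
    (lt_of_le_of_ne (Submodule.comap_mono hN.le) fun he => hyN (he.ge hy.1 : q ∈ _))
  refine ⟨v * P, hv, hvN, a, ha, ?_⟩
  rw [← mul_assoc]
  exact hav

/-- Division on the right by `x - a` leaves a constant. -/
theorem exists_eq_mul_X_sub_C_add (a : F) (p : SkewPoly σ δ) :
    ∃ (q : SkewPoly σ δ) (c : F), p = q * (X - C a) + C c := by
  have hd : degree (X - C a : SkewPoly σ δ) = ((1 : ℕ) : WithBot ℕ) := by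
    refine (degree_eq_iff _ 1).2 ⟨?_, fun i hi => ?_⟩
    · change coeff ((monomial 1 1 : SkewPoly σ δ) - monomial 0 a) 1 ≠ 0
      rw [coeff_sub, coeff_monomial, coeff_monomial]
      simp
    · change coeff ((monomial 1 1 : SkewPoly σ δ) - monomial 0 a) i = 0
      rw [coeff_sub, coeff_monomial, coeff_monomial, if_neg hi.ne, if_neg (by omega), sub_zero]
  have h0 : (X - C a : SkewPoly σ δ) ≠ 0 := fun h => by
    rw [h, (degree_eq_bot_iff _).2 rfl] at hd
    exact WithBot.bot_ne_coe hd
  obtain ⟨q, t, h, ht⟩ := exists_div p h0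
  rw [hd, degree_lt_iff] at ht
  refine ⟨q, coeff t 0, h.trans (congrArg _ (coeff_ext fun i => ?_))⟩
  change _ = coeff (monomial 0 (coeff t 0)) i
  rw [coeff_monomial]
  split_ifs with hi
  · rw [hi]
  · exact ht i (by omega)

theorem mem_of_C_mul_mem {I : Ideal (SkewPoly σ δ)} {c : F} (hc : c ≠ 0) {v : SkewPoly σ δ}
    (h : C c * v ∈ I) : v ∈ I := by
  have := I.mul_mem_left (C c⁻¹) h
  rwa [← mul_assoc, ← map_mul, inv_mul_cancel₀ hc, map_one, one_mul] at this

/-- Modulo `x - a` every skew polynomial is a constant, so an ideal strictly larger than `N`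
contains a nonzero constant, hence `1`, and `1` is the required eigenvector. -/
theorem isLinearlyFiltered_span_X_sub_C {A : Set F} {a : F} (ha : a ∈ A) :
    IsLinearlyFiltered A (Ideal.span {(X - C a : SkewPoly σ δ)}) := by
  intro N N' hIN hN
  have hX : (X - C a : SkewPoly σ δ) ∈ N := hIN (Ideal.mem_span_singleton_self _)
  obtain ⟨p, hp, hpN⟩ := SetLike.exists_of_lt hN
  obtain ⟨q, c, rfl⟩ := exists_eq_mul_X_sub_C_add a p
  have hc : C c ∈ N' := (N'.add_mem_iff_right (N'.mul_mem_left q (hN.le hX))).1 hp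
  have hcN : C c ∉ N := fun h => hpN (N.add_mem (N.mul_mem_left q hX) h)
  have hc0 : c ≠ 0 := by
    rintro rfl
    exact hcN (by rw [map_zero]; exact N.zero_mem)
  refine ⟨1, mem_of_C_mul_mem hc0 (by rwa [mul_one]), fun h => hcN ?_, a, ha, by rwa [mul_one]⟩
  rw [← mul_one (C c)]
  exact N.mul_mem_left _ h

theorem isLinearlyFiltered_span_X_sub_C_pow {A : Set F} {a : F} (ha : a ∈ A) (k : ℕ) :
    IsLinearlyFiltered A (Ideal.span {(X - C a : SkewPoly σ δ) ^ k}) := by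
  induction k with
  | zero =>
    rw [pow_zero, Ideal.span_singleton_one]
    exact isLinearlyFiltered_top A
  | succ k ih =>
    rw [pow_succ]
    exact ih.span_mul (isLinearlyFiltered_span_X_sub_C ha)

/-- Left ideals that are filtered by non-conjugate linear factors are comaximal. -/
theorem sup_eq_top_of_not_isConjugate {A B : Set F} {I J : Ideal (SkewPoly σ δ)}
    (hI : IsLinearlyFiltered A I) (hJ : IsLinearlyFiltered B J)
    (h : ∀ a ∈ A, ∀ b ∈ B, ¬ IsConjugate σ δ b a) : I ⊔ J = ⊤ := by
  by_contra hne
  obtain ⟨v, -, hv, b, hb, hbv⟩ := hJ _ _ le_sup_right (lt_top_iff_ne_top.2 hne)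
  -- The submodule of `R / (I ⊔ J)` generated by the eigenvector `v` is nonzero, so the filtration
  -- for `A` applies to it.
  have hlt : I ⊔ J < (I ⊔ J) ⊔ Ideal.span {v} :=
    left_lt_sup.2 fun hle => hv (hle (Ideal.mem_span_singleton_self v))
  obtain ⟨w, hw, hwL, a, ha, haw⟩ := hI _ _ le_sup_left hlt
  generalize I ⊔ J = L at *
  obtain ⟨l, hl, z, hz, rfl⟩ := Submodule.mem_sup.1 hw
  obtain ⟨p, rfl⟩ := Ideal.mem_span_singleton'.1 hz
  -- As `(x - b) v` vanishes modulo `L`, only the remainder `β` of `p` acts: the new eigenvector is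
  -- `β v` modulo `L`.
  obtain ⟨q, β, rfl⟩ := exists_eq_mul_X_sub_C_add b p
  have hq : q * (X - C b) * v ∈ L := by
    rw [mul_assoc]
    exact L.mul_mem_left q hbv
  have hβ : β ≠ 0 := by
    rintro rfl
    refine hwL (L.add_mem hl ?_)
    rwa [map_zero, add_zero]
  have h1 : (X - C a) * (C β * v) ∈ L := by
    have e : (X - C a) * (l + (q * (X - C b) + C β) * v) =
        ((X - C a) * l + (X - C a) * (q * (X - C b) * v)) + (X - C a) * (C β * v) := by
      rw [add_mul, mul_add, mul_add, add_assoc]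
    rw [e] at haw
    exact (L.add_mem_iff_right (L.add_mem (L.mul_mem_left _ hl) (L.mul_mem_left _ hq))).1 haw
  have e : (X - C a) * (C β * v) =
      C (σ β) * ((X - C b) * v) + C (σ β * b + δ.toFun β - a * β) * v := by
    rw [← mul_assoc, ← mul_assoc, ← add_mul, sub_mul, X_mul_C, mul_sub, map_sub, map_add, map_mul,
      map_mul]
    congr 1
    abel
  rw [e] at h1
  have h2 := (L.add_mem_iff_right (L.mul_mem_left _ hbv)).1 h1
  -- A nonzero constant is invertible, so it cannot carry `v` into `L`.
  have h3 : σ β * b + δ.toFun β - a * β = 0 := by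
    by_contra hc
    exact hv (mem_of_C_mul_mem hc h2)
  refine h a ha b hb ⟨β, hβ, ?_⟩
  rw [← add_mul, sub_eq_zero.1 h3, mul_inv_cancel_right₀ hβ]

end Filtered

/-! ### Dimension counts with remainders. -/

section Remainder

/-- The skew polynomials of degree less than `d`. -/
def degreeLT (σ : F →+* F) (δ : SkewDerivation σ) (d : ℕ) : Submodule F (SkewPoly σ δ) where
  carrier := {p | degree p < d}
  zero_mem' := (degree_lt_iff _ d).2 fun i _ => coeff_zero i
  add_mem' {p q} hp hq := (degree_lt_iff _ d).2 fun i hi => by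
    rw [coeff_add, (degree_lt_iff p d).1 hp i hi, (degree_lt_iff q d).1 hq i hi, add_zero]
  smul_mem' c p hp := (degree_lt_iff _ d).2 fun i hi => by
    rw [coeff_smul, (degree_lt_iff p d).1 hp i hi, mul_zero]

theorem mem_degreeLT {d : ℕ} {p : SkewPoly σ δ} : p ∈ degreeLT σ δ d ↔ degree p < d := Iff.rfl

/-- A skew polynomial of degree less than `d` is the sequence of its first `d` coefficients. -/
noncomputable def degreeLTEquiv (σ : F →+* F) (δ : SkewDerivation σ) (d : ℕ) :
    degreeLT σ δ d ≃ₗ[F] (Fin d → F) :=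
  LinearEquiv.ofBijective
    { toFun := fun (p : degreeLT σ δ d) (i : Fin d) => coeff p.1 i
      map_add' := fun _ _ => rfl
      map_smul' := fun _ _ => rfl } (by
    constructor
    · intro p q h
      refine Subtype.ext (coeff_ext fun i => ?_)
      by_cases hi : i < d
      · exact congrFun h ⟨i, hi⟩
      · rw [(degree_lt_iff _ d).1 p.2 i (not_lt.1 hi), (degree_lt_iff _ d).1 q.2 i (not_lt.1 hi)]
    · intro f
      let p : SkewPoly σ δ := (Finsupp.onFinset (Finset.range d)
        (fun i => if hi : i < d then f ⟨i, hi⟩ else 0) (fun i hi => by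
          by_contra hid
          exact hi (dif_neg fun h => hid (Finset.mem_range.2 h))) : ℕ →₀ F)
      have hp : ∀ i, coeff p i = if hi : i < d then f ⟨i, hi⟩ else 0 := fun i => rfl
      refine ⟨⟨p, (degree_lt_iff _ d).2 fun i hi => ?_⟩, funext fun i => ?_⟩
      · rw [hp, dif_neg (not_lt.2 hi)]
      · exact (hp i).trans (dif_pos i.2))

instance (d : ℕ) : Module.Finite F (degreeLT σ δ d) :=
  Module.Finite.equiv (degreeLTEquiv σ δ d).symm

theorem finrank_degreeLT (d : ℕ) : Module.finrank F (degreeLT σ δ d) = d := by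
  rw [(degreeLTEquiv σ δ d).finrank_eq, Module.finrank_fin_fun]

theorem eval_eq_of_sub_mem {G P R : SkewPoly σ δ} (hP : P ≠ 0) (hR : degree R < degree P)
    (h : G - R ∈ Ideal.span {P}) : eval G P = R := by
  obtain ⟨Q, hQ⟩ := Ideal.mem_span_singleton'.1 h
  exact (existsUnique_remainder G hP).unique (eval_spec G hP)
    ⟨hR, Q, by rw [hQ, sub_add_cancel]⟩

theorem sub_eval_mem_span (G : SkewPoly σ δ) {P : SkewPoly σ δ} (hP : P ≠ 0) :
    G - eval G P ∈ Ideal.span {P} := by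
  obtain ⟨Q, hQ⟩ := (eval_spec G hP).2
  exact Ideal.mem_span_singleton'.2 ⟨Q, by rw [eq_sub_iff_add_eq, ← hQ]⟩

/-- The left linear map sending `p` to the remainder of `p * H` on right division by `P`. -/
noncomputable def mulRemainder (H : SkewPoly σ δ) {P : SkewPoly σ δ} {d : ℕ} (hd : degree P = d)
    (hP : P ≠ 0) : SkewPoly σ δ →ₗ[F] degreeLT σ δ d where
  toFun p := ⟨eval (p * H) P, by rw [mem_degreeLT, ← hd]; exact (eval_spec _ hP).1⟩
  map_add' p q := Subtype.ext <| by
    have hp := (eval_spec (p * H) hP).1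
    have hq := (eval_spec (q * H) hP).1
    rw [hd] at hp hq
    refine eval_eq_of_sub_mem hP (((degreeLT σ δ d).add_mem hp hq).trans_eq hd.symm) ?_
    change (p + q) * H - (eval (p * H) P + eval (q * H) P) ∈ _
    rw [add_mul, add_sub_add_comm]
    exact Ideal.add_mem _ (sub_eval_mem_span _ hP) (sub_eval_mem_span _ hP)
  map_smul' c p := Subtype.ext <| by
    have hp := (eval_spec (p * H) hP).1
    rw [hd] at hp
    refine eval_eq_of_sub_mem hP (((degreeLT σ δ d).smul_mem c hp).trans_eq hd.symm) ?_
    change (c • p) * H - c • eval (p * H) P ∈ _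
    rw [← C_mul, ← C_mul, mul_assoc, ← mul_sub]
    exact Ideal.mul_mem_left _ _ (sub_eval_mem_span _ hP)

theorem coe_mulRemainder (H : SkewPoly σ δ) {P : SkewPoly σ δ} {d : ℕ} (hd : degree P = d)
    (hP : P ≠ 0) (p : SkewPoly σ δ) : (mulRemainder H hd hP p : SkewPoly σ δ) = eval (p * H) P :=
  rfl

theorem mulRemainder_eq_zero_iff (H : SkewPoly σ δ) {P : SkewPoly σ δ} {d : ℕ}
    (hd : degree P = d) (hP : P ≠ 0) (p : SkewPoly σ δ) :
    mulRemainder H hd hP p = 0 ↔ p * H ∈ Ideal.span {P} := by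
  rw [← Submodule.coe_eq_zero, coe_mulRemainder, eval_eq_zero_iff, Ideal.mem_span_singleton']
  exact exists_congr fun _ => eq_comm

instance : IsDomain (SkewPoly σ δ) :=
  haveI : NoZeroDivisors (SkewPoly σ δ) := ⟨fun {p q} h => by
    rwa [← degree_eq_bot_iff, degree_mul, WithBot.add_eq_bot, degree_eq_bot_iff,
      degree_eq_bot_iff] at h⟩
  haveI : Nontrivial (SkewPoly σ δ) := ⟨0, 1, fun h => by
    have := congrArg (fun p => coeff p 0) h
    rw [one_def, coeff_monomial] at this
    exact zero_ne_one (this.trans (if_pos rfl))⟩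
  NoZeroDivisors.to_isDomain _

/-- The left Ore condition. -/
theorem exists_ne_zero_mul_mem_span (H : SkewPoly σ δ) {P : SkewPoly σ δ} (hP : P ≠ 0) :
    ∃ p : SkewPoly σ δ, p ≠ 0 ∧ p * H ∈ Ideal.span {P} := by
  obtain ⟨d, hd⟩ := exists_degree_eq hP
  -- Multipliers of degree at most `d` form a space of dimension `d + 1`, while remainders modulo
  -- `P` have dimension `d`.
  obtain ⟨p, hp, hp0⟩ := (Submodule.ne_bot_iff _).1 (LinearMap.ker_ne_bot_of_finrank_lt
    (f := (mulRemainder H hd hP).comp (degreeLT σ δ (d + 1)).subtype)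
    (by rw [finrank_degreeLT, finrank_degreeLT]; exact d.lt_succ_self))
  exact ⟨p.1, fun h => hp0 (Subtype.ext h), (mulRemainder_eq_zero_iff H hd hP p.1).1 hp⟩

/-- If `H` is invertible modulo `P` then a generator of the left ideal `{q | q * H ∈ (P)}` has
the degree of `P`. -/
theorem degree_eq_of_mul_mem_iff {H P p : SkewPoly σ δ} (hP : P ≠ 0) (hp0 : p ≠ 0)
    (hp : ∀ q, q * H ∈ Ideal.span {P} ↔ q ∈ Ideal.span {p})
    (hc : Ideal.span {H} ⊔ Ideal.span {P} = ⊤) : degree p = degree P := by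
  obtain ⟨d, hd⟩ := exists_degree_eq hP
  obtain ⟨e, he⟩ := exists_degree_eq hp0
  -- This is `q ↦ q * H` as a map `R / Rp → R / RP`, with both quotients represented by remainders,
  -- of dimensions `e` and `d`.
  let f := (mulRemainder H hd hP).comp (degreeLT σ δ e).subtype
  have hf : Function.Bijective f := by
    constructor
    · rw [← LinearMap.ker_eq_bot, Submodule.eq_bot_iff]
      intro q hq
      have hqp := (hp q.1).1 ((mulRemainder_eq_zero_iff H hd hP q.1).1 hq)
      have hlt := q.2
      obtain ⟨t, ht⟩ := Ideal.mem_span_singleton'.1 hqp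
      rw [mem_degreeLT, ← ht, degree_mul, he] at hlt
      by_cases h0 : t = 0
      · exact Subtype.ext (by rw [← ht, h0, zero_mul]; rfl)
      · obtain ⟨k, hk⟩ := exists_degree_eq h0
        rw [hk, ← Nat.cast_add, Nat.cast_lt] at hlt
        omega
    · intro g
      -- With `1 = u H + v'` and `v' ∈ RP`, the factor `u` inverts `H` modulo `P`; a preimage of `g`
      -- is `g u` reduced modulo `p`.
      obtain ⟨u', hu', v', hv', huv⟩ := Submodule.mem_sup.1 (hc.ge (Submodule.mem_top (x := 1)))
      obtain ⟨u, rfl⟩ := Ideal.mem_span_singleton'.1 hu'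
      obtain ⟨hlt, t, ht⟩ := eval_spec (g.1 * u) hp0
      refine ⟨⟨eval (g.1 * u) p, by rwa [mem_degreeLT, ← he]⟩, Subtype.ext ?_⟩
      refine eval_eq_of_sub_mem hP (by rw [hd]; exact g.2) ?_
      change eval (g.1 * u) p * H - g.1 ∈ _
      have e1 : eval (g.1 * u) p = g.1 * u - t * p := by rw [eq_sub_iff_add_eq', ← ht]
      have e2 : eval (g.1 * u) p * H - g.1 = -(t * p * H) - g.1 * v' := by
        have e3 : g.1 * u * H = g.1 - g.1 * v' := by
          rw [eq_sub_iff_add_eq, mul_assoc, ← mul_add, huv, mul_one]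
        rw [e1, sub_mul, e3]
        abel
      rw [e2]
      refine Ideal.sub_mem _ (Ideal.neg_mem_iff _ |>.2 ((hp _).2 ?_)) (Ideal.mul_mem_left _ _ hv')
      exact Ideal.mul_mem_left _ _ (Ideal.mem_span_singleton_self p)
  have := (LinearEquiv.ofBijective f hf).finrank_eq
  rw [finrank_degreeLT, finrank_degreeLT] at this
  rw [hd, he, this]

end Remainder

/-! ### Vanishing ideals, minimal skew polynomials and unions. -/

section Vanishing

/-- `I(Ω)` as a left ideal. -/
def vanishingIdeal (Ω : Set (SkewPoly σ δ)) : Ideal (SkewPoly σ δ) where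
  carrier := vanishing Ω
  zero_mem' P _ := (eval_eq_zero_iff 0 P).2 ⟨0, (zero_mul P).symm⟩
  add_mem' {G H} hG hH := by
    rw [← sub_neg_eq_add, ← neg_one_mul]
    exact sub_mem_vanishing hG (mul_mem_vanishing _ hH)
  smul_mem' H _ hG := mul_mem_vanishing H hG

theorem mem_vanishingIdeal {Ω : Set (SkewPoly σ δ)} {G : SkewPoly σ δ} :
    G ∈ vanishingIdeal Ω ↔ ∀ P ∈ Ω, G ∈ Ideal.span {P} := by
  refine forall₂_congr fun P _ => (eval_eq_zero_iff G P).trans ?_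
  rw [Ideal.mem_span_singleton']
  exact exists_congr fun _ => eq_comm

theorem vanishingIdeal_union (Ω Ψ : Set (SkewPoly σ δ)) :
    vanishingIdeal (Ω ∪ Ψ) = vanishingIdeal Ω ⊓ vanishingIdeal Ψ := by
  ext G
  simp only [Submodule.mem_inf, mem_vanishingIdeal, Set.mem_union, or_imp, forall_and]

theorem isAlgebraicSet_iff {Ω : Set (SkewPoly σ δ)} :
    IsAlgebraicSet Ω ↔ ∃ G ∈ vanishingIdeal Ω, G ≠ 0 := by
  rw [← Submodule.ne_bot_iff, ne_eq, ← SetLike.coe_set_eq]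
  rfl

theorem minPoly_ne_zero {Ω : Set (SkewPoly σ δ)} (hΩ : IsAlgebraicSet Ω) : minPoly Ω ≠ 0 := by
  obtain ⟨-, ⟨d, hd, -⟩, -⟩ := minPoly_spec hΩ
  intro h
  rw [h, (degree_eq_bot_iff _).2 rfl] at hd
  exact WithBot.bot_ne_coe hd

/-- The remainder of an element of `I(Ω)` by `minPoly Ω` is again in `I(Ω)`, and minimality of the
degree makes it zero. -/
theorem span_minPoly {Ω : Set (SkewPoly σ δ)} (hΩ : IsAlgebraicSet Ω) :
    Ideal.span {minPoly Ω} = vanishingIdeal Ω := by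
  obtain ⟨hmem, -, hmin⟩ := minPoly_spec hΩ
  refine le_antisymm ((Ideal.span_singleton_le_iff_mem _).2 hmem) fun G hG => ?_
  obtain ⟨hlt, Q, hQ⟩ := eval_spec G (minPoly_ne_zero hΩ)
  have h0 : eval G (minPoly Ω) = 0 := by
    by_contra hne
    refine absurd (hmin _ ?_ hne) (not_le.2 hlt)
    rw [← sub_eq_iff_eq_add'.2 hQ]
    exact sub_mem_vanishing hG (mul_mem_vanishing Q hmem)
  rw [h0, add_zero] at hQ
  exact Ideal.mem_span_singleton'.2 ⟨Q, hQ.symm⟩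

/-- The Ore condition gives the two minimal skew polynomials a nonzero common left multiple. -/
theorem IsAlgebraicSet.union {Ω Ψ : Set (SkewPoly σ δ)} (hΩ : IsAlgebraicSet Ω)
    (hΨ : IsAlgebraicSet Ψ) : IsAlgebraicSet (Ω ∪ Ψ) := by
  obtain ⟨p, hp, hmem⟩ := exists_ne_zero_mul_mem_span (minPoly Ω) (minPoly_ne_zero hΨ)
  rw [span_minPoly hΨ] at hmem
  refine isAlgebraicSet_iff.2 ⟨p * minPoly Ω, ?_, mul_ne_zero hp (minPoly_ne_zero hΩ)⟩
  rw [vanishingIdeal_union]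
  exact ⟨mul_mem_vanishing p (minPoly_spec hΩ).1, hmem⟩

/-- The degrees of the minimal skew polynomials of comaximal sets add up. -/
theorem degree_minPoly_union {Ω Ψ : Set (SkewPoly σ δ)} (hΩ : IsAlgebraicSet Ω)
    (hΨ : IsAlgebraicSet Ψ) (hc : vanishingIdeal Ω ⊔ vanishingIdeal Ψ = ⊤) :
    degree (minPoly (Ω ∪ Ψ)) = degree (minPoly Ω) + degree (minPoly Ψ) := by
  have hU := hΩ.union hΨ
  have hspan := span_minPoly hU
  rw [vanishingIdeal_union] at hspan
  have hF := minPoly_ne_zero hΩ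
  obtain ⟨p, hp⟩ : ∃ p, p * minPoly Ω = minPoly (Ω ∪ Ψ) := by
    rw [← Ideal.mem_span_singleton', span_minPoly hΩ]
    exact (hspan.le (Ideal.mem_span_singleton_self _)).1
  have hp0 : p ≠ 0 := fun h => minPoly_ne_zero hU (by rw [← hp, h, zero_mul])
  rw [← span_minPoly hΩ, ← span_minPoly hΨ] at hc
  rw [← hp, degree_mul, degree_eq_of_mul_mem_iff (minPoly_ne_zero hΨ) hp0 (fun q => ?_) hc,
    add_comm]
  -- Left multiples of `minPoly Ω` already vanish on `Ω`, so vanishing on `Ψ` means vanishing on the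
  -- union. Cancelling `minPoly Ω` then shows that `p` generates the left ideal of such `q`, whence
  -- `p` has the degree of `minPoly Ψ`.
  have h1 : q * minPoly Ω ∈ Ideal.span {minPoly Ψ} ↔
      q * minPoly Ω ∈ Ideal.span {minPoly (Ω ∪ Ψ)} := by
    rw [hspan, span_minPoly hΨ]
    exact ⟨fun h => ⟨mul_mem_vanishing q (minPoly_spec hΩ).1, h⟩, fun h => h.2⟩
  rw [h1, ← hp, Ideal.mem_span_singleton', Ideal.mem_span_singleton']
  refine exists_congr fun t => ?_
  rw [← mul_assoc]
  exact mul_left_inj' hF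

/-- A common element `P` would put both vanishing ideals inside `RP`, which is proper because `P`
has positive degree. -/
theorem disjoint_of_sup_vanishingIdeal_eq_top {Ω Ψ : Set (SkewPoly σ δ)}
    (hdeg : ∀ P ∈ Ω, 1 ≤ degree P) (hc : vanishingIdeal Ω ⊔ vanishingIdeal Ψ = ⊤) :
    Disjoint Ω Ψ := by
  rw [Set.disjoint_left]
  intro P hP hP'
  have hle : vanishingIdeal Ω ⊔ vanishingIdeal Ψ ≤ Ideal.span {P} :=
    sup_le (fun G hG => mem_vanishingIdeal.1 hG P hP) fun G hG => mem_vanishingIdeal.1 hG P hP'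
  rw [hc] at hle
  obtain ⟨Q, hQ⟩ := Ideal.mem_span_singleton'.1 (hle (Submodule.mem_top (x := 1)))
  have h1 : degree (Q * P) = ((0 : ℕ) : WithBot ℕ) := by
    rw [hQ, degree_eq_iff, one_def]
    refine ⟨?_, fun i hi => ?_⟩
    · rw [coeff_monomial, if_pos rfl]
      exact one_ne_zero
    · rw [coeff_monomial, if_neg hi.ne]
  have hPd := hdeg P hP
  have hne : Q ≠ 0 ∧ P ≠ 0 := mul_ne_zero_iff.1 (by rw [hQ]; exact one_ne_zero)
  obtain ⟨k, hk⟩ := exists_degree_eq hne.1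
  obtain ⟨d, hd⟩ := exists_degree_eq hne.2
  rw [degree_mul, hk, hd, ← Nat.cast_add, Nat.cast_inj] at h1
  rw [hd, ← Nat.cast_one, Nat.cast_le] at hPd
  omega

theorem isLinearlyFiltered_vanishingIdeal_range {ι : Type*} [Finite ι] (a : ι → F) (r : ι → ℕ) :
    IsLinearlyFiltered (Set.range a)
      (vanishingIdeal (Set.range fun i => (X - C (a i) : SkewPoly σ δ) ^ r i)) := by
  classical
  cases nonempty_fintype ι
  have h : vanishingIdeal (Set.range fun i => (X - C (a i) : SkewPoly σ δ) ^ r i) =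
      Finset.univ.inf fun i => Ideal.span {(X - C (a i) : SkewPoly σ δ) ^ r i} := by
    ext G
    rw [mem_vanishingIdeal, Set.forall_mem_range, Submodule.mem_finsetInf]
    simp
  rw [h]
  exact Finset.inf_induction (isLinearlyFiltered_top _) (fun _ hI _ hJ => hI.inf hJ)
    fun i _ => isLinearlyFiltered_span_X_sub_C_pow (Set.mem_range_self i) (r i)

theorem PIndependent.union {Ω Ψ : Set (SkewPoly σ δ)} (hΩ : PIndependent Ω)
    (hΨ : PIndependent Ψ) (hc : vanishingIdeal Ω ⊔ vanishingIdeal Ψ = ⊤) :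
    PIndependent (Ω ∪ Ψ) := by
  have hdisj := disjoint_of_sup_vanishingIdeal_eq_top hΩ.1 hc
  obtain ⟨hΩ1, hΩf, hΩa, hΩd⟩ := hΩ
  obtain ⟨hΨ1, hΨf, hΨa, hΨd⟩ := hΨ
  refine ⟨fun P hP => hP.elim (hΩ1 P) (hΨ1 P), hΩf.union hΨf, hΩa.union hΨa, ?_⟩
  -- Disjointness ensures that no degree is lost in the sum over the union.
  rw [degree_minPoly_union hΩa hΨa hc, hΩd, hΨd, finsum_mem_union hdisj hΩf hΨf]

end Vanishing

end SkewPoly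

/-! ### The union theorem. -/

theorem mainTheorem5 {F : Type*} [DivisionRing F] (σ : F →+* F) (δ : SkewDerivation σ)
    (n m : ℕ) (hn : 1 ≤ n) (hm : 1 ≤ m)
    (a : Fin n → F) (b : Fin m → F) (r : Fin n → ℕ) (s : Fin m → ℕ)
    (hr : ∀ i, 1 ≤ r i) (hs : ∀ j, 1 ≤ s j)
    (Ω Ψ : Set (SkewPoly σ δ))
    (hΩ : Ω = Set.range fun i => (SkewPoly.X - SkewPoly.C (a i)) ^ r i)
    (hΨ : Ψ = Set.range fun j => (SkewPoly.X - SkewPoly.C (b j)) ^ s j)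
    (hΩcard : Ω.ncard = n) (hΨcard : Ψ.ncard = m)
    (hΩind : SkewPoly.PIndependent Ω) (hΨind : SkewPoly.PIndependent Ψ)
    (hconj : ∀ i j, ¬ SkewPoly.IsConjugate σ δ (b j) (a i)) :
    (Ω ∪ Ψ).ncard = n + m ∧ SkewPoly.PIndependent (Ω ∪ Ψ) := by

  -- Non-conjugacy enters only here; both the size and the P-independence of the union follow from
  -- comaximality.
  have hc : SkewPoly.vanishingIdeal Ω ⊔ SkewPoly.vanishingIdeal Ψ = ⊤ := by
    rw [hΩ, hΨ]
    refine SkewPoly.sup_eq_top_of_not_isConjugate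
      (SkewPoly.isLinearlyFiltered_vanishingIdeal_range a r)
      (SkewPoly.isLinearlyFiltered_vanishingIdeal_range b s) ?_
    rintro _ ⟨i, rfl⟩ _ ⟨j, rfl⟩
    exact hconj i j
  refine ⟨?_, hΩind.union hΨind hc⟩
  rw [Set.ncard_union_eq (SkewPoly.disjoint_of_sup_vanishingIdeal_eq_top hΩind.1 hc)
    hΩind.2.1 hΨind.2.1, hΩcard, hΨcard]
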